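/- Let $m\ge 1$ be an integer. The equation $k^{2m}+k^{2m-1}-1=0$ has exactly one real solution outside $(0,1)$; denote it by $c_{2m,1}$ (it lies in $(-2,-1)$). Let $c_{2m,2}$ be the unique solution of $k^{2m}+k^{2m-1}-2=0$ in $[-2,c_{2m,1})$. Let $\delta>0$, $\mathcal B=[-\delta,\delta]$ and $f\in C^{2m+1}(\mathcal B)$, and let $0$ be a $2m$-fold root of $f$, i.e. $f^{(j)}(0)=0$ for $0\le j\le 2m-1$ and $f^{(2m)}(0)\neq 0$. Let $$k_0\in(-\infty,c_{2m,2})\cup(-1,0)\cup(0,1)\cup(1,+\infty).$$ Then there is $\varepsilon>0$ such that for every $e_0$ with $0<|e_0|<\varepsilon$ the secant iteration $$e_{n+1}=e_n-f(e_n)\,\frac{e_{n-1}-e_n}{f(e_{n-1})-f(e_n)}\quad(n\ge 1),\qquad e_1:=k_0e_0,$$ is well defined, with $e_n\in\mathcal B$, $e_n\ne 0$ and $f(e_n)\neq f(e_{n+1})$ for all $n\ge 0$, and the sequence $\{e_n\}$ of errors converges Q-linearly to $0$: $e_n\to 0$, and $\lim_{n\to\infty}|e_{n+1}|/|e_n|$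 exists and lies in $(0,1)$. -/

import Mathlib

namespace SecantMultipleRoot

open Set Filter Topology

/-- The iterates of the secant method for `f` with initial values `x₀`, `x₁`:
`x_{n+2} = x_{n+1} - f(x_{n+1}) (x_n - x_{n+1}) / (f(x_n) - f(x_{n+1}))`.
An iterate is meaningful only if the denominators met so far are nonzero. -/
noncomputable def secantSeq (f : ℝ → ℝ) (x₀ x₁ : ℝ) : ℕ → ℝ
  | 0 => x₀
  | 1 => x₁
  | n + 2 =>
      secantSeq f x₀ x₁ (n + 1) -
        f (secantSeq f x₀ x₁ (n + 1)) *
          ((secantSeq f x₀ x₁ n - secantSeq f x₀ x₁ (n + 1)) /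
            (f (secantSeq f x₀ x₁ n) - f (secantSeq f x₀ x₁ (n + 1))))

/-- `0` is an `n`-fold root of `f`, a function on the interval `[-δ, δ]`: the derivatives of
order `0, …, n - 1` vanish at `0`, the one of order `n` does not. -/
def IsFoldRootAtZero (f : ℝ → ℝ) (δ : ℝ) (n : ℕ) : Prop :=
  (∀ j < n, iteratedDerivWithin j f (Icc (-δ) δ) 0 = 0) ∧
    iteratedDerivWithin n f (Icc (-δ) δ) 0 ≠ 0

/-- Q-linear convergence of `x` to `L`: `x_n → L` and `|x_{n+1} - L| / |x_n - L| → c` for some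
`c ∈ (0, 1)`. The quotients are meaningful if `x_n ≠ L` for all `n`. -/
def QLinearConvergesTo (x : ℕ → ℝ) (L : ℝ) : Prop :=
  Tendsto x atTop (𝓝 L) ∧
    ∃ c : ℝ, 0 < c ∧ c < 1 ∧
      Tendsto (fun n => |x (n + 1) - L| / |x n - L|) atTop (𝓝 c)

/-- The characteristic polynomial `k^n + k^(n-1) - 1` (used for `n ≥ 1`). -/
def charP (n : ℕ) (k : ℝ) : ℝ := k ^ n + k ^ (n - 1) - 1

/-- The polynomial `k^n + k^(n-1) - 2` (used for `n ≥ 1`). -/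
def charQ (n : ℕ) (k : ℝ) : ℝ := k ^ n + k ^ (n - 1) - 2

theorem charP_neg {m : ℕ} (hm : 1 ≤ m) (t : ℝ) :
    charP (2 * m) (-t) = t ^ (2 * m - 1) * (t - 1) - 1 := by
  obtain ⟨l, rfl⟩ : ∃ l, m = l + 1 := ⟨m - 1, by omega⟩
  have h1 : 2 * (l + 1) - 1 = 2 * l + 1 := by omega
  have h2 : 2 * (l + 1) = (2 * l + 1) + 1 := by omega
  have h3 : Odd (2 * l + 1) := ⟨l, rfl⟩
  rw [charP, h1, h2, pow_succ (-t), h3.neg_pow]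
  ring

theorem strictMonoOn_aux (n : ℕ) :
    StrictMonoOn (fun t : ℝ => t ^ n * (t - 1)) (Ici 1) := by
  intro a ha b hb hab
  have ha : (1 : ℝ) ≤ a := ha
  have h1 : a ^ n ≤ b ^ n := pow_le_pow_left₀ (by linarith) hab.le n
  have h2 : (0 : ℝ) < a ^ n := pow_pos (by linarith) n
  show a ^ n * (a - 1) < b ^ n * (b - 1)
  nlinarith

/-- Intermediate values of `t ^ n * (t - 1)`. -/
theorem exists_aux {n : ℕ} {a v : ℝ} (ha : a ≤ 2) (h1 : a ^ n * (a - 1) < v)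
    (h2 : v ≤ 2 ^ n) : ∃ t ∈ Ioc a 2, t ^ n * (t - 1) = v := by
  have hc : ContinuousOn (fun t : ℝ => t ^ n * (t - 1)) (Icc a 2) := by fun_prop
  exact intermediate_value_Ioc ha hc ⟨h1, by simpa [show (2 : ℝ) - 1 = 1 by norm_num] using h2⟩

theorem two_le_pow_aux {m : ℕ} (hm : 1 ≤ m) : (2 : ℝ) ≤ 2 ^ (2 * m - 1) := by
  simpa using pow_le_pow_right₀ (by norm_num : (1 : ℝ) ≤ 2) (by omega : 1 ≤ 2 * m - 1)

/-- A real root of `charP (2 * m)` outside `(0, 1)` is less than `-1`. -/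
theorem lt_neg_one_of_charP {m : ℕ} (hm : 1 ≤ m) {k : ℝ} (hk : charP (2 * m) k = 0)
    (hk' : k ∉ Ioo (0 : ℝ) 1) : k < -1 := by
  by_contra! h
  rcases le_or_gt k 0 with h0 | h0
  · have := charP_neg hm (-k)
    rw [neg_neg, hk] at this
    have h1 : 0 ≤ (-k) ^ (2 * m - 1) := pow_nonneg (by linarith) _
    nlinarith
  · have h1 : 1 ≤ k := by
      by_contra! h1
      exact hk' ⟨h0, h1⟩
    have h2 : 1 ≤ k ^ (2 * m) := one_le_pow₀ h1
    have h3 : 1 ≤ k ^ (2 * m - 1) := one_le_pow₀ h1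
    rw [charP] at hk
    linarith

theorem existsUnique_c₁ {m : ℕ} (hm : 1 ≤ m) :
    ∃! k : ℝ, charP (2 * m) k = 0 ∧ k ∉ Ioo (0 : ℝ) 1 := by
  obtain ⟨t, ht, hte⟩ := exists_aux (n := 2 * m - 1) (a := 1) (v := 1) (by norm_num) (by norm_num)
    (by linarith [two_le_pow_aux hm])
  refine ⟨-t, ⟨by rw [charP_neg hm, hte, sub_self], fun h => by linarith [h.1, ht.1]⟩, ?_⟩
  rintro k ⟨hk, hk'⟩
  have hlt := lt_neg_one_of_charP hm hk hk'
  have h1 := charP_neg hm (-k)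
  rw [neg_neg, hk] at h1
  have : -k = t := (strictMonoOn_aux (2 * m - 1)).injOn (mem_Ici.2 (by linarith))
    (mem_Ici.2 ht.1.le) (show (-k) ^ (2 * m - 1) * (-k - 1) = t ^ (2 * m - 1) * (t - 1) by linarith)
  linarith

/-- The constant `c_{2m,1}`: the unique real root of `k^(2m) + k^(2m-1) - 1` that does not lie in
`(0, 1)`. -/
noncomputable def c₁ (m : ℕ) (hm : 1 ≤ m) : ℝ := (existsUnique_c₁ hm).exists.choose

theorem c₁_spec {m : ℕ} (hm : 1 ≤ m) :
    charP (2 * m) (c₁ m hm) = 0 ∧ c₁ m hm ∉ Ioo (0 : ℝ) 1 :=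
  (existsUnique_c₁ hm).exists.choose_spec

theorem c₁_mem {m : ℕ} (hm : 1 ≤ m) : c₁ m hm ∈ Ioo (-2 : ℝ) (-1) := by
  obtain ⟨h, h'⟩ := c₁_spec hm
  have hlt := lt_neg_one_of_charP hm h h'
  refine ⟨?_, hlt⟩
  by_contra! h2
  have h1 := charP_neg hm (-(c₁ m hm))
  rw [neg_neg, h] at h1
  have := (strictMonoOn_aux (2 * m - 1)).monotoneOn (mem_Ici.2 (by norm_num : (1 : ℝ) ≤ 2))
    (mem_Ici.2 (by linarith)) (by linarith : (2 : ℝ) ≤ -(c₁ m hm))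
  linarith [two_le_pow_aux hm]

theorem existsUnique_c₂ {m : ℕ} (hm : 1 ≤ m) :
    ∃! k : ℝ, k ∈ Ico (-2 : ℝ) (c₁ m hm) ∧ charQ (2 * m) k = 0 := by
  have hq : ∀ t : ℝ, charQ (2 * m) (-t) = t ^ (2 * m - 1) * (t - 1) - 2 := fun t => by
    have := charP_neg hm t
    rw [charP] at this
    rw [charQ]
    linarith
  obtain ⟨hl, hr⟩ := c₁_mem hm
  have h1 := charP_neg hm (-(c₁ m hm))
  rw [neg_neg, (c₁_spec hm).1] at h1
  obtain ⟨t, ht, hte⟩ := exists_aux (n := 2 * m - 1) (a := -(c₁ m hm)) (v := 2) (by linarith)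
    (by linarith) (two_le_pow_aux hm)
  refine ⟨-t, ⟨⟨by linarith [ht.2], by linarith [ht.1]⟩, by rw [hq, hte, sub_self]⟩, ?_⟩
  rintro k ⟨hk, hk0⟩
  have h2 := hq (-k)
  rw [neg_neg, hk0] at h2
  have : -k = t := (strictMonoOn_aux (2 * m - 1)).injOn (mem_Ici.2 (by linarith [hk.2]))
    (mem_Ici.2 (by linarith [ht.1]))
    (show (-k) ^ (2 * m - 1) * (-k - 1) = t ^ (2 * m - 1) * (t - 1) by linarith)
  linarith

/-- The constant `c_{2m,2}`: the unique root of `k^(2m) + k^(2m-1) - 2` in `[-2, c_{2m,1})`. -/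
noncomputable def c₂ (m : ℕ) (hm : 1 ≤ m) : ℝ := (existsUnique_c₂ hm).exists.choose

theorem c₂_spec {m : ℕ} (hm : 1 ≤ m) :
    c₂ m hm ∈ Ico (-2 : ℝ) (c₁ m hm) ∧ charQ (2 * m) (c₂ m hm) = 0 :=
  (existsUnique_c₂ hm).exists.choose_spec

end SecantMultipleRoot

namespace SecantMultipleRoot

open Set Filter Topology

/-! ### The map governing the quotients of consecutive errors -/

/-! Write `f x = x ^ (n + 1) * g x` with `n + 1 = 2m` and `g → a ≠ 0` at `0`. The quotients k =
e_{j+1}/e_j then evolve by `secantRatio n w`, where w, the ratio of consecutive values of `g`, tends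
to 1 as the errors shrink. So the limit map F = `secantRatio n 1` decides everything. F has a fixed
point p in (1/2, 1), and |F(k) - p| ≤ p|k - p| on [0, 1) (`abs_secantRatio_one_sub_le`). This
contraction survives small perturbations of w, so quotients starting within 1 - p of p converge to p
(`goodQuotient_of_abs_sub_lt`). F sends (-∞, c₂) into (-1, 0), that into (1, ∞), that into (0, 1),
and that into the ball about p; `GoodQuotient.of_secantRatio` pulls convergence back along each
arrow. -/

/-- The quotient `z / y` of errors after one secant step `(x, y) ↦ (y, z)` for the function
`x ^ (n + 1) * g x`, expressed by `k = y / x` and `w = g y / g x`. -/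
noncomputable def secantRatio (n : ℕ) (w k : ℝ) : ℝ := (1 - w * k ^ n) / (1 - w * k ^ (n + 1))

theorem secantRatio_one (n : ℕ) (k : ℝ) :
    secantRatio n 1 k = (1 - k ^ n) / (1 - k ^ (n + 1)) := by
  simp [secantRatio]

theorem secant_step_eq {f : ℝ → ℝ} {n : ℕ} {x y u v : ℝ} (hx : x ≠ 0) (hu : u ≠ 0)
    (hfx : f x = x ^ (n + 1) * u) (hfy : f y = y ^ (n + 1) * v)
    (h : 1 - v / u * (y / x) ^ (n + 1) ≠ 0) :
    f x ≠ f y ∧ y - f y * ((x - y) / (f x - f y)) = secantRatio n (v / u) (y / x) * y := by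
  have hsub : f x - f y = x ^ (n + 1) * u * (1 - v / u * (y / x) ^ (n + 1)) := by
    rw [hfx, hfy, div_pow]
    field_simp
  have hne : f x - f y ≠ 0 := by
    rw [hsub]
    exact mul_ne_zero (mul_ne_zero (pow_ne_zero _ hx) hu) h
  refine ⟨sub_ne_zero.1 hne, ?_⟩
  have hr : secantRatio n (v / u) (y / x) * (1 - v / u * (y / x) ^ (n + 1)) =
      1 - v / u * (y / x) ^ n := div_mul_cancel₀ _ h
  have h1 : secantRatio n (v / u) (y / x) * (f x - f y) = x ^ n * (x * u) - x * y ^ n * v := by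
    rw [hsub]
    calc _ = x ^ (n + 1) * u *
          (secantRatio n (v / u) (y / x) * (1 - v / u * (y / x) ^ (n + 1))) := by ring
      _ = _ := by
        rw [hr, div_pow]
        field_simp
        ring
  have h2 : y - f y * ((x - y) / (f x - f y)) = (y * (f x - f y) - f y * (x - y)) / (f x - f y) := by
    field_simp
  rw [h2, div_eq_iff hne, mul_right_comm, h1, hfx, hfy]
  ring

/-! ### The limit map: mapping of intervals, contraction, fixed point, perturbation -/

theorem one_le_geom_sum {n : ℕ} (hn : 1 ≤ n) {x : ℝ} (hx : 0 ≤ x) :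
    1 ≤ ∑ i ∈ Finset.range n, x ^ i := by
  simpa using Finset.single_le_sum (f := fun i => x ^ i) (fun i _ => pow_nonneg hx i)
    (Finset.mem_range.2 hn)

/-- With S(x) the shorter sum, the longer one is 1 + xS(x), and xS(x) - zS(z) = z(S(x) - S(z)) + (x
- z)S(x); induction bounds the first term. -/
theorem geom_sum_sub_le (n : ℕ) {x z : ℝ} (hz : 0 ≤ z) (hzx : z ≤ x) :
    (∑ i ∈ Finset.range n, x ^ i) - ∑ i ∈ Finset.range n, z ^ i ≤
      (∑ i ∈ Finset.range n, x ^ i) * (∑ i ∈ Finset.range n, z ^ i) * (x - z) := by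
  have hx := hz.trans hzx
  induction n with
  | zero => simp
  | succ n ih =>
    have hX : ∑ i ∈ Finset.range n, x ^ i ≤ ∑ i ∈ Finset.range (n + 1), x ^ i := by
      rw [Finset.sum_range_succ]
      linarith [pow_nonneg hx n]
    have hZ : 0 ≤ ∑ i ∈ Finset.range (n + 1), z ^ i := Finset.sum_nonneg fun i _ => pow_nonneg hz i
    refine le_trans ?_ (mul_le_mul_of_nonneg_right (mul_le_mul_of_nonneg_right hX hZ)
      (sub_nonneg.2 hzx))
    rw [geom_sum_succ, geom_sum_succ (x := z)]
    nlinarith [mul_le_mul_of_nonneg_left ih hz]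

theorem secantRatio_one_eq_geom_sum (n : ℕ) {x : ℝ} (hx : 0 ≤ x) (hx1 : x < 1) :
    secantRatio n 1 x =
      (∑ i ∈ Finset.range n, x ^ i) / (1 + x * ∑ i ∈ Finset.range n, x ^ i) := by
  have h1 := geom_sum_mul_neg x n
  have h2 : 0 ≤ ∑ i ∈ Finset.range n, x ^ i := Finset.sum_nonneg fun i _ => pow_nonneg hx i
  have h3 : x ^ (n + 1) < 1 := pow_lt_one₀ hx hx1 (by omega)
  rw [secantRatio_one, div_eq_div_iff (by linarith) (by positivity), ← h1, pow_succ]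
  linear_combination ((∑ i ∈ Finset.range n, x ^ i) * x) * h1

theorem secantRatio_one_mem_Ioo {n : ℕ} (hn : 1 ≤ n) {k : ℝ} (hk : k ∈ Ioo (0 : ℝ) 1) :
    secantRatio n 1 k ∈ Ioo (0 : ℝ) 1 := by
  obtain ⟨h0, h1⟩ := hk
  have h2 : k ^ n < 1 := pow_lt_one₀ h0.le h1 (by omega)
  have h3 : k ^ (n + 1) < k ^ n := pow_lt_pow_right_of_lt_one₀ h0 h1 (by omega)
  rw [secantRatio_one]
  exact ⟨div_pos (by linarith) (by linarith), (div_lt_one (by linarith)).2 (by linarith)⟩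

theorem secantRatio_one_mem_Ioo_of_one_lt {n : ℕ} (hn : 1 ≤ n) {k : ℝ} (hk : 1 < k) :
    secantRatio n 1 k ∈ Ioo (0 : ℝ) 1 := by
  have h2 : 1 < k ^ n := one_lt_pow₀ hk (by omega)
  have h3 : k ^ n < k ^ (n + 1) := pow_lt_pow_right₀ hk (by omega)
  rw [secantRatio_one, ← neg_div_neg_eq]
  exact ⟨div_pos (by linarith) (by linarith), (div_lt_one (by linarith)).2 (by linarith)⟩

theorem one_lt_secantRatio_one {n : ℕ} (hn : Odd n) {k : ℝ} (hk : k ∈ Ioo (-1 : ℝ) 0) :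
    1 < secantRatio n 1 k := by
  have h2 : k ^ n < 0 := hn.pow_neg hk.2
  have h3 : 0 < k ^ (n + 1) := hn.add_one.pow_pos hk.2.ne
  have h4 : k ^ (n + 1) < 1 := by
    rw [← hn.add_one.pow_abs]
    exact pow_lt_one₀ (abs_nonneg k) (abs_lt.2 ⟨hk.1, by linarith [hk.2]⟩) (by omega)
  rw [secantRatio_one, one_lt_div (by linarith)]
  linarith

/-- The denominator is negative, so the value exceeds -1 exactly under `hQ`; this is where c₂ comes
from. -/
theorem secantRatio_one_mem_Ioo_neg {n : ℕ} (hn : Odd n) {k : ℝ} (hk : k < 0)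
    (hQ : 2 < k ^ (n + 1) + k ^ n) : secantRatio n 1 k ∈ Ioo (-1 : ℝ) 0 := by
  have h2 : k ^ n < 0 := hn.pow_neg hk
  rw [secantRatio_one]
  exact ⟨by rw [lt_div_iff_of_neg (by linarith)]; linarith,
    div_neg_of_pos_of_neg (by linarith) (by linarith)⟩

/-- On `[0, 1)` the map `secantRatio n 1` is decreasing, with small slopes. -/
theorem secantRatio_one_sub_mem {n : ℕ} (hn : 1 ≤ n) {x z : ℝ} (hz : 0 ≤ z) (hzx : z ≤ x)
    (hx : x < 1) :
    secantRatio n 1 z - secantRatio n 1 x ∈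
      Icc 0 (secantRatio n 1 x * secantRatio n 1 z * (x - z)) := by
  have hx0 := hz.trans hzx
  rw [secantRatio_one_eq_geom_sum n hz (hzx.trans_lt hx), secantRatio_one_eq_geom_sum n hx0 hx]
  have h1 := geom_sum_sub_le n hz hzx
  have h2 : ∑ i ∈ Finset.range n, z ^ i ≤ ∑ i ∈ Finset.range n, x ^ i :=
    Finset.sum_le_sum fun i _ => pow_le_pow_left₀ hz hzx i
  have h3 := one_le_geom_sum hn hz
  set Z := ∑ i ∈ Finset.range n, z ^ i
  set X := ∑ i ∈ Finset.range n, x ^ i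
  have hX : 0 < 1 + x * X := by nlinarith
  have hZ : 0 < 1 + z * Z := by nlinarith
  have e1 : Z / (1 + z * Z) - X / (1 + x * X) =
      (X * Z * (x - z) - (X - Z)) / ((1 + x * X) * (1 + z * Z)) := by
    rw [div_sub_div _ _ hZ.ne' hX.ne', mul_comm (1 + z * Z)]
    ring
  have e2 : X / (1 + x * X) * (Z / (1 + z * Z)) * (x - z) =
      (X * Z * (x - z)) / ((1 + x * X) * (1 + z * Z)) := by
    field_simp
  rw [e1, e2]
  exact ⟨div_nonneg (by linarith) (by positivity),
    div_le_div_of_nonneg_right (by linarith) (by positivity)⟩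

theorem secantRatio_one_nonneg_le {n : ℕ} {x : ℝ} (hx : 0 ≤ x) (hx1 : x < 1) :
    secantRatio n 1 x ∈ Icc (0 : ℝ) 1 := by
  have h2 : x ^ n ≤ 1 := pow_le_one₀ hx hx1.le
  have h3 : x ^ (n + 1) ≤ x ^ n := pow_le_pow_of_le_one hx hx1.le (by omega)
  have h4 : x ^ (n + 1) < 1 := pow_lt_one₀ hx hx1 (by omega)
  rw [secantRatio_one]
  exact ⟨div_nonneg (by linarith) (by linarith), (div_le_one (by linarith)).2 (by linarith)⟩

theorem abs_secantRatio_one_sub_le {n : ℕ} (hn : 1 ≤ n) {p k : ℝ} (hp : p ∈ Ico (0 : ℝ) 1)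
    (hfix : secantRatio n 1 p = p) (hk : k ∈ Ico (0 : ℝ) 1) :
    |secantRatio n 1 k - p| ≤ p * |k - p| := by
  have hG := secantRatio_one_nonneg_le (n := n) hk.1 hk.2
  rcases le_total k p with h | h
  · obtain ⟨h1, h2⟩ := secantRatio_one_sub_mem hn hk.1 h hp.2
    rw [hfix] at h1 h2
    rw [abs_of_nonneg h1, abs_of_nonpos (by linarith)]
    nlinarith [mul_nonneg (mul_nonneg hp.1 (sub_nonneg.2 h)) (sub_nonneg.2 hG.2)]
  · obtain ⟨h1, h2⟩ := secantRatio_one_sub_mem hn hp.1 h hk.2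
    rw [hfix] at h1 h2
    rw [abs_of_nonpos (by linarith), abs_of_nonneg (by linarith)]
    nlinarith [mul_nonneg (mul_nonneg hp.1 (sub_nonneg.2 h)) (sub_nonneg.2 hG.2)]

/-- One step from (0, 1) lands in the ball where the contraction argument starts: for k ≤ p because
F(k) < 1, for k ≥ p by contraction. -/
theorem abs_secantRatio_one_sub_lt {n : ℕ} (hn : 1 ≤ n) {p k : ℝ} (hp : p ∈ Ico (0 : ℝ) 1)
    (hfix : secantRatio n 1 p = p) (hk : k ∈ Ioo (0 : ℝ) 1) :
    |secantRatio n 1 k - p| < 1 - p := by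
  rcases le_total k p with h | h
  · obtain ⟨h1, -⟩ := secantRatio_one_sub_mem hn hk.1.le h hp.2
    rw [hfix] at h1
    rw [abs_of_nonneg h1]
    linarith [(secantRatio_one_mem_Ioo hn hk).2]
  · have h1 := abs_secantRatio_one_sub_le hn hp hfix ⟨hk.1.le, hk.2⟩
    rw [abs_of_nonneg (by linarith : 0 ≤ k - p)] at h1
    nlinarith [hp.1, hp.2, hk.2]

theorem exists_secantRatio_fixed {n : ℕ} (hn : 1 ≤ n) :
    ∃ p ∈ Ioo (1 / 2 : ℝ) 1, secantRatio n 1 p = p := by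
  have hc : ContinuousOn (fun t : ℝ => t ^ n * (1 + t)) (Icc (1 / 2) 1) := by fun_prop
  have h1 : (1 / 2 : ℝ) ^ n ≤ 1 / 2 := by
    simpa using pow_le_pow_of_le_one (by norm_num : (0 : ℝ) ≤ 1 / 2) (by norm_num) hn
  obtain ⟨p, hp, hpe⟩ := intermediate_value_Ioo (by norm_num) hc
    (show (1 : ℝ) ∈ Ioo _ _ from ⟨by linarith, by norm_num⟩)
  refine ⟨p, hp, ?_⟩
  have hp0 : 0 < p := by linarith [hp.1]
  have h2 : p ^ (n + 1) < 1 := pow_lt_one₀ hp0.le hp.2 (by omega)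
  rw [secantRatio_one, div_eq_iff (by linarith), pow_succ]
  have hpe : p ^ n * (1 + p) = 1 := hpe
  -- The fixed-point equation factors as (1 - p)(p^n(1 + p) - 1) = 0.
  linear_combination (p - 1) * hpe

/-- The dependence of `secantRatio` on its perturbation parameter. -/
theorem abs_secantRatio_sub_le {n : ℕ} {w k r : ℝ} (hk : 0 ≤ k) (hkr : k ≤ r) (hr : r < 1)
    (hw : |w - 1| ≤ 1 - r) :
    0 < 1 - w * k ^ (n + 1) ∧
      |secantRatio n w k - secantRatio n 1 k| ≤ |w - 1| / (1 - r) ^ 3 := by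
  have hs : 0 < 1 - r := by linarith
  have h0 : 0 ≤ k ^ (n + 1) := pow_nonneg hk _
  have h1 : k ^ (n + 1) ≤ k := by
    simpa using pow_le_pow_of_le_one hk (hkr.trans hr.le) (by omega : 1 ≤ n + 1)
  have h2 : k ^ n ≤ 1 := pow_le_one₀ hk (hkr.trans hr.le)
  have h3 : k ^ (n + 1) ≤ k ^ n := pow_le_pow_of_le_one hk (hkr.trans hr.le) (by omega)
  -- Here w ≤ 2 - r and k^(n+1) ≤ r, and 1 - r(2 - r) = (1 - r)^2.
  have hD : (1 - r) ^ 2 ≤ 1 - w * k ^ (n + 1) := by nlinarith [(abs_le.1 hw).2]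
  have hD' : 1 - r ≤ 1 - k ^ (n + 1) := by linarith
  have hpos : 0 < 1 - w * k ^ (n + 1) := lt_of_lt_of_le (by positivity) hD
  have hpos' : 0 < 1 - k ^ (n + 1) := hs.trans_le hD'
  refine ⟨hpos, ?_⟩
  have e : secantRatio n w k - secantRatio n 1 k =
      (1 - w) * (k ^ n - k ^ (n + 1)) / ((1 - w * k ^ (n + 1)) * (1 - k ^ (n + 1))) := by
    rw [secantRatio_one, secantRatio, div_sub_div _ _ hpos.ne' hpos'.ne']
    ring
  rw [e, abs_div, abs_mul, abs_sub_comm 1 w, abs_of_nonneg (sub_nonneg.2 h3),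
    abs_of_pos (mul_pos hpos hpos')]
  gcongr
  · exact mul_le_of_le_one_right (abs_nonneg _) (by linarith)
  · calc (1 - r) ^ 3 = (1 - r) ^ 2 * (1 - r) := by ring
      _ ≤ _ := mul_le_mul hD hD' hs.le hpos.le

theorem tendsto_zero_of_le_mul_add {u b : ℕ → ℝ} {q : ℝ} (hq0 : 0 ≤ q) (hq : q < 1)
    (hu : ∀ n, 0 ≤ u n) (h : ∀ n, u (n + 1) ≤ q * u n + b n) (hb : Tendsto b atTop (𝓝 0)) :
    Tendsto u atTop (𝓝 0) := by
  refine tendsto_order.2 ⟨fun a ha => Eventually.of_forall fun n => ha.trans_le (hu n),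
    fun ε hε => ?_⟩
  have hs : 0 < (1 - q) * (ε / 2) := mul_pos (by linarith) (by linarith)
  obtain ⟨N, hN⟩ := eventually_atTop.1 ((tendsto_order.1 hb).2 _ hs)
  have key : ∀ j, u (N + j) ≤ q ^ j * u N + ε / 2 := by
    intro j
    induction j with
    | zero => simp; linarith
    | succ j ih =>
      have := h (N + j)
      have := hN (N + j) (by omega)
      rw [← add_assoc, pow_succ']
      nlinarith [mul_le_mul_of_nonneg_left ih hq0]
  have hlim : Tendsto (fun j => q ^ j * u N) atTop (𝓝 0) := by
    simpa using (tendsto_pow_atTop_nhds_zero_of_lt_one hq0 hq).mul_const (u N)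
  obtain ⟨M, hM⟩ := eventually_atTop.1 ((tendsto_order.1 hlim).2 _ (half_pos hε))
  refine eventually_atTop.2 ⟨N + M, fun n hn => ?_⟩
  obtain ⟨j, rfl⟩ : ∃ j, n = N + j := ⟨n - N, by omega⟩
  linarith [key j, hM j (by omega)]

/-! ### Well-definedness and convergence of the secant method -/

/-- The secant method for `f` on `[-δ, δ]` started at `x`, `y` is well defined, avoids `0`, and
converges Q-linearly to `0`. -/
def SecantConverges (f : ℝ → ℝ) (δ x y : ℝ) : Prop :=
  (∀ n : ℕ, secantSeq f x y n ∈ Icc (-δ) δ ∧ secantSeq f x y n ≠ 0 ∧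
      f (secantSeq f x y n) ≠ f (secantSeq f x y (n + 1))) ∧
    QLinearConvergesTo (secantSeq f x y) 0

theorem secantSeq_add_two (f : ℝ → ℝ) (x y : ℝ) (n : ℕ) :
    secantSeq f x y (n + 2) = secantSeq f x y (n + 1) - f (secantSeq f x y (n + 1)) *
      ((secantSeq f x y n - secantSeq f x y (n + 1)) /
        (f (secantSeq f x y n) - f (secantSeq f x y (n + 1)))) := by
  rw [secantSeq]

theorem secantSeq_succ (f : ℝ → ℝ) (x y : ℝ) (n : ℕ) :
    secantSeq f x y (n + 1) = secantSeq f y (y - f y * ((x - y) / (f x - f y))) n := by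
  induction n using Nat.strong_induction_on with
  | _ n ih =>
    match n, ih with
    | 0, _ => simp [secantSeq]
    | 1, _ => simp [secantSeq]
    | n + 2, ih =>
      rw [secantSeq_add_two f x y (n + 1), secantSeq_add_two f y, ih (n + 1) (by omega),
        ih n (by omega)]

theorem SecantConverges.of_step {f : ℝ → ℝ} {δ x y : ℝ} (hx : x ∈ Icc (-δ) δ) (hx0 : x ≠ 0)
    (hxy : f x ≠ f y)
    (h : SecantConverges f δ y (y - f y * ((x - y) / (f x - f y)))) : SecantConverges f δ x y := by
  obtain ⟨h1, h2, c, hc0, hc1, hc⟩ := h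
  refine ⟨fun n => ?_, ?_, c, hc0, hc1, ?_⟩
  · cases n with
    | zero => exact ⟨hx, hx0, hxy⟩
    | succ n =>
      rw [secantSeq_succ, secantSeq_succ]
      exact h1 n
  · refine (tendsto_add_atTop_iff_nat 1).1 ?_
    simpa only [secantSeq_succ] using h2
  · refine (tendsto_add_atTop_iff_nat 1).1 ?_
    simpa only [secantSeq_succ f x y] using hc

/-- The secant method converges for all starting values `x`, `k' * x` with `x ≠ 0` small and `k'`
close to `k`. -/
def GoodQuotient (f : ℝ → ℝ) (δ k : ℝ) : Prop :=
  ∀ᶠ z : ℝ × ℝ in 𝓝[≠] 0 ×ˢ 𝓝 k, SecantConverges f δ z.1 (z.2 * z.1)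

theorem tendsto_div_one {α : Type*} {l : Filter α} {g : ℝ → ℝ} {a : ℝ} {φ ψ : α → ℝ}
    (hg : Tendsto g (𝓝[≠] 0) (𝓝 a)) (ha : a ≠ 0) (hφ : Tendsto φ l (𝓝[≠] 0))
    (hψ : Tendsto ψ l (𝓝[≠] 0)) : Tendsto (fun z => g (ψ z) / g (φ z)) l (𝓝 1) := by
  have h := (hg.comp hψ).div (hg.comp hφ) ha
  rwa [div_self ha] at h

/-- The perturbed step only lands near F(k), which is why `GoodQuotient` asks for a whole
neighbourhood of k. -/
theorem GoodQuotient.of_secantRatio {f g : ℝ → ℝ} {δ a k : ℝ} {n : ℕ} (hδ : 0 < δ)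
    (hfg : ∀ x ≠ 0, f x = x ^ (n + 1) * g x) (hg : Tendsto g (𝓝[≠] 0) (𝓝 a)) (ha : a ≠ 0)
    (hk0 : k ≠ 0) (hk : k ^ (n + 1) ≠ 1) (h : GoodQuotient f δ (secantRatio n 1 k)) :
    GoodQuotient f δ k := by
  have hx : Tendsto (fun z : ℝ × ℝ => z.1) (𝓝[≠] 0 ×ˢ 𝓝 k) (𝓝[≠] 0) := tendsto_fst
  have hk' : Tendsto (fun z : ℝ × ℝ => z.2) (𝓝[≠] 0 ×ˢ 𝓝 k) (𝓝 k) := tendsto_snd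
  have hx0 : ∀ᶠ z : ℝ × ℝ in 𝓝[≠] 0 ×ˢ 𝓝 k, z.1 ≠ 0 := hx.eventually self_mem_nhdsWithin
  have hk0' : ∀ᶠ z : ℝ × ℝ in 𝓝[≠] 0 ×ˢ 𝓝 k, z.2 ≠ 0 := hk'.eventually_ne hk0
  have hy : Tendsto (fun z : ℝ × ℝ => z.2 * z.1) (𝓝[≠] 0 ×ˢ 𝓝 k) (𝓝[≠] 0) := by
    refine tendsto_nhdsWithin_iff.2 ⟨?_, ?_⟩
    · simpa using hk'.mul (hx.mono_right nhdsWithin_le_nhds)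
    · filter_upwards [hx0, hk0'] with z h1 h2 using mul_ne_zero h2 h1
  have hw := tendsto_div_one hg ha hx hy
  have hden : Tendsto (fun z : ℝ × ℝ => 1 - g (z.2 * z.1) / g z.1 * z.2 ^ (n + 1))
      (𝓝[≠] 0 ×ˢ 𝓝 k) (𝓝 (1 - 1 * k ^ (n + 1))) :=
    tendsto_const_nhds.sub (hw.mul (hk'.pow _))
  have hne : 1 - 1 * k ^ (n + 1) ≠ 0 := by
    rw [one_mul]
    exact sub_ne_zero.2 hk.symm
  have hratio : Tendsto (fun z : ℝ × ℝ => secantRatio n (g (z.2 * z.1) / g z.1) z.2)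
      (𝓝[≠] 0 ×ˢ 𝓝 k) (𝓝 (secantRatio n 1 k)) :=
    (tendsto_const_nhds.sub (hw.mul (hk'.pow _))).div hden hne
  have hball : ∀ᶠ z : ℝ × ℝ in 𝓝[≠] 0 ×ˢ 𝓝 k, z.1 ∈ Icc (-δ) δ :=
    hx.eventually (mem_nhdsWithin_of_mem_nhds (Icc_mem_nhds (by linarith) hδ))
  filter_upwards [(hy.prodMk hratio).eventually h, hx0, hk0', hball, hden.eventually_ne hne,
    hx.eventually (hg.eventually_ne ha)] with z h1 h2 h3 h4 h5 h6
  have hdiv : z.2 * z.1 / z.1 = z.2 := mul_div_cancel_right₀ _ h2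
  obtain ⟨h7, h8⟩ := secant_step_eq h2 h6 (hfg _ h2) (hfg _ (mul_ne_zero h3 h2))
    (by rwa [hdiv])
  refine SecantConverges.of_step h4 h2 h7 ?_
  rw [h8, hdiv]
  exact h1

theorem goodQuotient_of_abs_sub_lt {f g : ℝ → ℝ} {δ a k p : ℝ} {n : ℕ} (hn : 1 ≤ n) (hδ : 0 < δ)
    (hfg : ∀ x ≠ 0, f x = x ^ (n + 1) * g x) (hg : Tendsto g (𝓝[≠] 0) (𝓝 a)) (ha : a ≠ 0)
    (hp : p ∈ Ioo (1 / 2 : ℝ) 1) (hfix : secantRatio n 1 p = p) (hk : |k - p| < 1 - p) :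
    GoodQuotient f δ k := by
  obtain ⟨ρ, hkρ, hρ⟩ := exists_between hk
  obtain ⟨hp0, hp1⟩ := hp
  have hρ0 : 0 < ρ := (abs_nonneg _).trans_lt hkρ
  have hs : 0 < 1 - (p + ρ) := by linarith
  -- The first bound permits `abs_secantRatio_sub_le` with r = p + ρ; the second keeps the ρ-ball
  -- invariant, since pρ + (1 - p)ρ = ρ.
  have hη : 0 < min (1 - (p + ρ)) ((1 - p) * ρ * (1 - (p + ρ)) ^ 3) :=
    lt_min hs (by have : 0 < 1 - p := by linarith
                  positivity)
  have hw : ∀ᶠ z : ℝ × ℝ in 𝓝[≠] 0 ×ˢ 𝓝[≠] 0,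
      |g z.2 / g z.1 - 1| < min (1 - (p + ρ)) ((1 - p) * ρ * (1 - (p + ρ)) ^ 3) := by
    have := tendsto_div_one hg ha (tendsto_fst (f := 𝓝[≠] (0 : ℝ)) (g := 𝓝[≠] (0 : ℝ))) tendsto_snd
    exact this.eventually (Metric.ball_mem_nhds 1 hη)
  obtain ⟨s, hs', hsw⟩ := (eventually_prod_self_iff (r := fun x y => |g y / g x - 1| < _)).1 hw
  obtain ⟨τ, hτ0, hτ⟩ : ∃ τ > 0, ∀ x : ℝ, x ≠ 0 → |x| < τ → x ∈ s ∧ g x ≠ 0 ∧ x ∈ Icc (-δ) δ := by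
    have hev : ∀ᶠ x in 𝓝[≠] (0 : ℝ), x ∈ s ∧ g x ≠ 0 ∧ x ∈ Icc (-δ) δ :=
      Eventually.and hs' ((hg.eventually_ne ha).and
        (mem_nhdsWithin_of_mem_nhds (Icc_mem_nhds (by linarith) hδ)))
    obtain ⟨τ, hτ0, hτ⟩ := Metric.mem_nhdsWithin_iff.1 hev
    exact ⟨τ, hτ0, fun x h1 h2 => hτ ⟨by simpa using h2, h1⟩⟩
  have hstart : ∀ᶠ z : ℝ × ℝ in 𝓝[≠] 0 ×ˢ 𝓝 k, z.1 ≠ 0 ∧ |z.1| < τ ∧ |z.2 - p| < ρ := by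
    have h1 : ∀ᶠ x : ℝ in 𝓝[≠] 0, x ≠ 0 ∧ |x| < τ :=
      Eventually.and self_mem_nhdsWithin
        (mem_nhdsWithin_of_mem_nhds (by simpa [Metric.ball] using Metric.ball_mem_nhds (0 : ℝ) hτ0))
    have h2 : ∀ᶠ k' : ℝ in 𝓝 k, |k' - p| < ρ :=
      (continuous_abs.comp (continuous_id.sub continuous_const)).continuousAt.eventually_lt
        continuousAt_const hkρ
    filter_upwards [h1.prod_mk h2] with z hz using ⟨hz.1.1, hz.1.2, hz.2⟩
  filter_upwards [hstart] with z hz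
  obtain ⟨hx0, hxτ, hkz⟩ := hz
  set e := secantSeq f z.1 (z.2 * z.1) with he
  have hstep : ∀ j, (e j ≠ 0 ∧ |e j| < τ ∧ |e (j + 1) / e j - p| ≤ ρ) →
      (e (j + 1) ≠ 0 ∧ |e (j + 1)| ≤ (p + ρ) * |e j| ∧ f (e j) ≠ f (e (j + 1)) ∧
        |g (e (j + 1)) / g (e j) - 1| < min (1 - (p + ρ)) ((1 - p) * ρ * (1 - (p + ρ)) ^ 3) ∧
        |e (j + 2) / e (j + 1) - p| ≤ p * |e (j + 1) / e j - p| +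
          |g (e (j + 1)) / g (e j) - 1| / (1 - (p + ρ)) ^ 3) := by
    rintro j ⟨h0, h1, h2⟩
    obtain ⟨h3, h4⟩ := abs_le.1 h2
    -- Uses ρ < 1 - p < 1/2 < p.
    have hk0 : 0 < e (j + 1) / e j := by linarith
    have hk1 : e (j + 1) / e j ≤ p + ρ := by linarith
    have h5 : e (j + 1) ≠ 0 := fun h => by simp [h] at hk0
    have h6 : |e (j + 1)| ≤ (p + ρ) * |e j| := by
      rw [← div_le_iff₀ (abs_pos.2 h0), ← abs_div, abs_of_pos hk0]
      exact hk1
    have h7 : |e (j + 1)| < τ := by nlinarith [abs_nonneg (e j)]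
    obtain ⟨hs1, hg1, -⟩ := hτ _ h0 h1
    obtain ⟨hs2, hg2, -⟩ := hτ _ h5 h7
    have hw' : |g (e (j + 1)) / g (e j) - 1| < _ := hsw _ hs1 _ hs2
    obtain ⟨hD, hF⟩ := abs_secantRatio_sub_le (n := n) hk0.le hk1 (by linarith)
      (hw'.le.trans (min_le_left _ _))
    obtain ⟨h8, h9⟩ := secant_step_eq h0 hg1 (hfg _ h0) (hfg _ h5) hD.ne'
    refine ⟨h5, h6, h8, hw', ?_⟩
    have h10 : e (j + 2) / e (j + 1) =
        secantRatio n (g (e (j + 1)) / g (e j)) (e (j + 1) / e j) := by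
      rw [div_eq_iff h5, ← h9, he, secantSeq_add_two]
    have h11 := abs_secantRatio_one_sub_le hn ⟨by linarith, hp1⟩ hfix
      (⟨hk0.le, by linarith⟩ : e (j + 1) / e j ∈ Ico (0 : ℝ) 1)
    rw [h10]
    linarith [abs_sub_le (secantRatio n (g (e (j + 1)) / g (e j)) (e (j + 1) / e j))
      (secantRatio n 1 (e (j + 1) / e j)) p]
  have hinv : ∀ j, e j ≠ 0 ∧ |e j| < τ ∧ |e (j + 1) / e j - p| ≤ ρ := by
    intro j
    induction j with
    | zero =>
      refine ⟨hx0, hxτ, ?_⟩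
      have : e 1 / e 0 = z.2 := mul_div_cancel_right₀ _ hx0
      rw [this]
      exact hkz.le
    | succ j ih =>
      obtain ⟨h1, h2, -, h4, h5⟩ := hstep j ih
      refine ⟨h1, by nlinarith [abs_nonneg (e j), ih.2.1], h5.trans ?_⟩
      have h6 : |g (e (j + 1)) / g (e j) - 1| / (1 - (p + ρ)) ^ 3 ≤ (1 - p) * ρ := by
        rw [div_le_iff₀ (by positivity)]
        exact (h4.trans_le (min_le_right _ _)).le
      nlinarith [ih.2.2]
  have hgeom : ∀ j, |e j| ≤ (p + ρ) ^ j * |e 0| := by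
    intro j
    induction j with
    | zero => simp
    | succ j ih =>
      rw [pow_succ', mul_assoc]
      exact (hstep j (hinv j)).2.1.trans (mul_le_mul_of_nonneg_left ih (by linarith))
  have hlim : Tendsto e atTop (𝓝 0) := by
    refine squeeze_zero_norm hgeom ?_
    simpa using (tendsto_pow_atTop_nhds_zero_of_lt_one (by linarith : 0 ≤ p + ρ)
      (by linarith)).mul_const |e 0|
  have hlim' : Tendsto e atTop (𝓝[≠] 0) :=
    tendsto_nhdsWithin_iff.2 ⟨hlim, Eventually.of_forall fun j => (hinv j).1⟩
  have hwlim : Tendsto (fun j => g (e (j + 1)) / g (e j)) atTop (𝓝 1) :=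
    tendsto_div_one hg ha hlim' (hlim'.comp (tendsto_add_atTop_nat 1))
  have hb : Tendsto (fun j => |g (e (j + 1)) / g (e j) - 1| / (1 - (p + ρ)) ^ 3) atTop (𝓝 0) := by
    simpa using ((hwlim.sub_const 1).abs.div_const ((1 - (p + ρ)) ^ 3))
  have hq := tendsto_zero_of_le_mul_add (u := fun j => |e (j + 1) / e j - p|) (by linarith) hp1
    (fun _ => abs_nonneg _) (fun j => (hstep j (hinv j)).2.2.2.2) hb
  refine ⟨fun j => ⟨(hτ _ (hinv j).1 (hinv j).2.1).2.2, (hinv j).1, (hstep j (hinv j)).2.2.1⟩,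
    hlim, p, by linarith, hp1, ?_⟩
  have h1 : Tendsto (fun j => e (j + 1) / e j) atTop (𝓝 p) := tendsto_iff_norm_sub_tendsto_zero.2 hq
  simpa [abs_div, abs_of_pos (by linarith : 0 < p)] using h1.abs

/-! ### Local form of `f` at the root, and the role of c₂ -/

/-- Peano's form of Taylor's theorem at a multiple root. -/
theorem IsFoldRootAtZero.tendsto_div_pow {f : ℝ → ℝ} {δ : ℝ} (hδ : 0 < δ) {n : ℕ}
    (hf : ContDiffOn ℝ n f (Icc (-δ) δ)) (h : IsFoldRootAtZero f δ n) :
    ∃ a : ℝ, a ≠ 0 ∧ Tendsto (fun x => f x / x ^ n) (𝓝[≠] 0) (𝓝 a) := by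
  have h0 : (0 : ℝ) ∈ Icc (-δ) δ := ⟨by linarith, hδ.le⟩
  have hT := taylor_isLittleO (convex_Icc (-δ) δ) h0 hf
  rw [nhdsWithin_eq_nhds.2 (Icc_mem_nhds (by linarith) hδ)] at hT
  set a := ((n.factorial : ℝ))⁻¹ * iteratedDerivWithin n f (Icc (-δ) δ) 0
  have hev : ∀ x, taylorWithinEval f n (Icc (-δ) δ) 0 x = a * x ^ n := by
    intro x
    rw [taylor_within_apply, Finset.sum_range_succ, Finset.sum_eq_zero, zero_add, sub_zero,
      smul_eq_mul]
    · ring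
    · intro j hj
      rw [h.1 j (Finset.mem_range.1 hj), smul_zero]
  refine ⟨a, mul_ne_zero (inv_ne_zero (by positivity)) h.2, ?_⟩
  have h1 := (hT.mono (nhdsWithin_le_nhds (s := {0}ᶜ))).tendsto_div_nhds_zero
  have h2 := h1.add_const a
  rw [zero_add] at h2
  refine h2.congr' ?_
  filter_upwards [self_mem_nhdsWithin] with x hx
  have hx : x ≠ 0 := hx
  rw [hev, sub_zero]
  field_simp
  ring

/-- With t = -k the sum is t^(2m-1)(t - 1), increasing for t ≥ 1 and equal to 2 at t = -c₂. -/
theorem two_lt_of_lt_c₂ {m : ℕ} (hm : 1 ≤ m) {k : ℝ} (hk : k < c₂ m hm) :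
    k < -1 ∧ 2 < k ^ (2 * m) + k ^ (2 * m - 1) := by
  obtain ⟨⟨-, hc⟩, hQ⟩ := c₂_spec hm
  have hc₁ := (c₁_mem hm).2
  have h1 := charP_neg hm (-k)
  have h2 := charP_neg hm (-(c₂ m hm))
  rw [neg_neg, charP] at h1 h2
  rw [charQ] at hQ
  have h3 : (-(c₂ m hm)) ^ (2 * m - 1) * (-(c₂ m hm) - 1) < (-k) ^ (2 * m - 1) * (-k - 1) :=
    strictMonoOn_aux (2 * m - 1) (mem_Ici.2 (by linarith)) (mem_Ici.2 (by linarith)) (by linarith)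
  exact ⟨by linarith, by linarith⟩

end SecantMultipleRoot

theorem lemma4p10 (m : ℕ) (hm : 1 ≤ m) (δ : ℝ) (hδ : 0 < δ) (f : ℝ → ℝ)
    (hf : ContDiffOn ℝ ((2 * m + 1 : ℕ) : WithTop ℕ∞) f (Set.Icc (-δ) δ))
    (hroot : SecantMultipleRoot.IsFoldRootAtZero f δ (2 * m))
    (k₀ : ℝ)
    (hk₀ : k₀ ∈ Set.Iio (SecantMultipleRoot.c₂ m hm) ∪ Set.Ioo (-1) 0 ∪ Set.Ioo 0 1 ∪ Set.Ioi 1) :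
    ∃ ε : ℝ, 0 < ε ∧ ∀ e₀ : ℝ, e₀ ≠ 0 → |e₀| < ε →
      (∀ n : ℕ,
        SecantMultipleRoot.secantSeq f e₀ (k₀ * e₀) n ∈ Set.Icc (-δ) δ ∧
        SecantMultipleRoot.secantSeq f e₀ (k₀ * e₀) n ≠ 0 ∧
        f (SecantMultipleRoot.secantSeq f e₀ (k₀ * e₀) n) ≠
          f (SecantMultipleRoot.secantSeq f e₀ (k₀ * e₀) (n + 1))) ∧
      SecantMultipleRoot.QLinearConvergesTo
        (SecantMultipleRoot.secantSeq f e₀ (k₀ * e₀)) 0 := by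
  open SecantMultipleRoot Set Filter Topology in
  obtain ⟨n, hn⟩ : ∃ n, 2 * m = n + 1 := ⟨2 * m - 1, by omega⟩
  have hodd : Odd n := ⟨m - 1, by omega⟩
  have hn1 : 1 ≤ n := hodd.pos
  obtain ⟨a, ha, hg⟩ := hroot.tendsto_div_pow hδ (hf.of_le (by exact_mod_cast Nat.le_succ _))
  rw [hn] at hg
  have hfg : ∀ x ≠ 0, f x = x ^ (n + 1) * (f x / x ^ (n + 1)) := fun x hx =>
    (mul_div_cancel₀ _ (pow_ne_zero _ hx)).symm
  obtain ⟨p, hp, hfix⟩ := exists_secantRatio_fixed hn1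
  -- The real poles of F are among ±1.
  have step : ∀ {k : ℝ}, k ≠ 0 → k ≠ 1 → k ≠ -1 → GoodQuotient f δ (secantRatio n 1 k) →
      GoodQuotient f δ k := fun {k} h0 h1 h2 =>
    GoodQuotient.of_secantRatio hδ hfg hg ha h0 fun h =>
      ((pow_eq_one_iff_of_ne_zero (by omega)).1 h).elim h1 fun h => h2 h.1
  have good01 : ∀ {k : ℝ}, k ∈ Ioo (0 : ℝ) 1 → GoodQuotient f δ k := fun {k} hk =>
    step hk.1.ne' hk.2.ne (by linarith [hk.1]) <|
      goodQuotient_of_abs_sub_lt hn1 hδ hfg hg ha hp hfix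
        (abs_secantRatio_one_sub_lt hn1 ⟨by linarith [hp.1], hp.2⟩ hfix hk)
  have good1 : ∀ {k : ℝ}, 1 < k → GoodQuotient f δ k := fun {k} hk =>
    step (by linarith) hk.ne' (by linarith) (good01 (secantRatio_one_mem_Ioo_of_one_lt hn1 hk))
  have goodneg : ∀ {k : ℝ}, k ∈ Ioo (-1 : ℝ) 0 → GoodQuotient f δ k := fun {k} hk =>
    step hk.2.ne (by linarith [hk.2]) hk.1.ne' (good1 (one_lt_secantRatio_one hodd hk))
  have good : GoodQuotient f δ k₀ := by
    rcases hk₀ with ((hk | hk) | hk) | hk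
    · obtain ⟨h1, h2⟩ := two_lt_of_lt_c₂ hm hk
      rw [show 2 * m - 1 = n by omega, hn] at h2
      exact step (by linarith) (by linarith) h1.ne
        (goodneg (secantRatio_one_mem_Ioo_neg hodd (by linarith) h2))
    · exact goodneg hk
    · exact good01 hk
    · exact good1 hk
  have hev : ∀ᶠ x in 𝓝[≠] (0 : ℝ), SecantConverges f δ x (k₀ * x) := by
    have hpair : Tendsto (fun x : ℝ => (x, k₀)) (𝓝[≠] 0) (𝓝[≠] 0 ×ˢ 𝓝 k₀) :=
      tendsto_id.prodMk tendsto_const_nhds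
    exact hpair.eventually good
  obtain ⟨ε, hε, h⟩ := Metric.mem_nhdsWithin_iff.1 hev
  exact ⟨ε, hε, fun e₀ h0 h1 => h ⟨by simpa using h1, h0⟩⟩
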